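/- A permutation $\pi\in S_n$ contains a pattern $p\in S_m$ if its one-line notation has a subsequence that is order-isomorphic to $p$; otherwise it avoids $p$. Let $\mathrm{av}_n^k(1324,1342)$ denote the number of permutations $\pi\in S_n$ that avoid both $1324$ and $1342$ and have exactly $k$ inversions, i.e. exactly $k$ pairs $i<j$ with $\pi_i>\pi_j$. Let $$C(x)=\prod_{i\ge 1}\frac{1+x^i}{1-x^i}$$ as a formal power series. Then $C(x)$ is the limit generating function of $\{1324,1342\}$: for every $k\ge 0$ one has $\mathrm{av}_n^k(1324,1342)=[x^k]\,C(x)$ for all sufficiently large $n$. Moreover, for all nonnegative integers $k$ and $n$ with $n\ge\frac{k+7}{2}$, the difference $\mathrm{av}_{n+1}^k(1324,1342)-\mathrm{av}_n^k(1324,1342)$ is nonnegative and $$\mathrm{av}_{n+1}^k(1324,1342)-\mathrm{av}_n^k(1324,1342)=[x^k]\;x^{n-1}(2+2x)\prod_{i\ge1}\frac{1+x^i}{1-x^i},$$ $$\mathrm{av}_n^k(1324,1342)=[x^k]\left(\frac{1-x-x^{n-1}(2+2x)}{1-x}\cdot\prod_{i\ge1}\frac{1+x^i}{1-x^i}\right).$$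 -/

import Mathlib

open PowerSeries
open scoped PowerSeries.WithPiTopology

/-- `π ∈ S_n` contains the pattern `p ∈ S_m`: some subsequence of the one-line notation of `π`,
at positions `f 0 < f 1 < ⋯`, is order-isomorphic to `p`. -/
def ContainsPattern {m n : ℕ} (p : Equiv.Perm (Fin m)) (π : Equiv.Perm (Fin n)) : Prop :=
  ∃ f : Fin m ↪o Fin n, ∀ i j : Fin m, p i < p j ↔ π (f i) < π (f j)

/-- `π` avoids every pattern in the collection `B` of permutations of arbitrary lengths. -/
def AvoidsAll {n : ℕ} (B : Set (Σ m : ℕ, Equiv.Perm (Fin m))) (π : Equiv.Perm (Fin n)) : Prop :=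
  ∀ p ∈ B, ¬ ContainsPattern p.2 π

/-- The number of inversions, i.e. of pairs `i < j` with `π i > π j`. -/
def inversionCount {n : ℕ} (π : Equiv.Perm (Fin n)) : ℕ :=
  (Finset.univ.filter fun q : Fin n × Fin n => q.1 < q.2 ∧ π q.2 < π q.1).card

/-- `Av_n^k(B)`: the `B`-avoiding permutations of length `n` with exactly `k` inversions. -/
def AvSet (n k : ℕ) (B : Set (Σ m : ℕ, Equiv.Perm (Fin m))) : Set (Equiv.Perm (Fin n)) :=
  {π | AvoidsAll B π ∧ inversionCount π = k}

/-- `av_n^k(B)`, the cardinality of `Av_n^k(B)`. -/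
noncomputable def av (n k : ℕ) (B : Set (Σ m : ℕ, Equiv.Perm (Fin m))) : ℕ :=
  (AvSet n k B).ncard

/-- `C` is the limit generating function of `B`: for every `k`, the numbers `av_n^k(B)` are equal
to the coefficient of `x^k` in `C` for all sufficiently large `n`. -/
def IsLimitGenFun (B : Set (Σ m : ℕ, Equiv.Perm (Fin m))) (C : ℚ⟦X⟧) : Prop :=
  ∀ k : ℕ, ∃ N : ℕ, ∀ n : ℕ, N ≤ n → (av n k B : ℚ) = coeff k C

/-- The permutation `1324` (with positions and values shifted to start at `0`). -/
def perm1324 : Equiv.Perm (Fin 4) :=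
  ⟨![0, 2, 1, 3], ![0, 2, 1, 3], by decide, by decide⟩

/-- The permutation `1342` (with positions and values shifted to start at `0`). -/
def perm1342 : Equiv.Perm (Fin 4) :=
  ⟨![0, 2, 3, 1], ![0, 3, 1, 2], by decide, by decide⟩

/-- The collection `{1324, 1342}`. -/
def basis1324And1342 : Set (Σ m : ℕ, Equiv.Perm (Fin m)) :=
  {⟨4, perm1324⟩, ⟨4, perm1342⟩}

/-- The infinite product `∏_{i ≥ 1} (1 + x^i) / (1 - x^i)` of formal power series. -/
noncomputable def overpartitionSeries : ℚ⟦X⟧ :=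
  ∏' i : ℕ, (1 + X ^ (i + 1)) * (1 - X ^ (i + 1))⁻¹

/-- The infinite product defining `overpartitionSeries` converges. -/
theorem multipliable_overpartitionSeries :
    Multipliable fun i : ℕ => (1 + X ^ (i + 1) : ℚ⟦X⟧) * (1 - X ^ (i + 1))⁻¹ := by
  have key : ∀ i : ℕ, (1 + X ^ (i + 1) : ℚ⟦X⟧) * (1 - X ^ (i + 1))⁻¹
      = 1 + X ^ (i + 1) * (2 * (1 - X ^ (i + 1))⁻¹) := by
    intro i
    have h : (1 - X ^ (i + 1) : ℚ⟦X⟧) * (1 - X ^ (i + 1))⁻¹ = 1 :=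
      PowerSeries.mul_inv_cancel _ (by simp)
    linear_combination h
  simp_rw [key]
  apply PowerSeries.WithPiTopology.multipliable_one_add_of_tendsto_order_atTop_nhds_top
  refine ENat.tendsto_nhds_top_iff_natCast_lt.mpr fun n => Filter.eventually_atTop.mpr ⟨n, ?_⟩
  intro i hi
  refine lt_of_lt_of_le ?_ (PowerSeries.le_order_mul ..)
  rw [PowerSeries.order_X_pow]
  exact lt_of_lt_of_le (by exact_mod_cast Nat.lt_succ_of_le hi) le_self_add

/-!
Delete the first entry `v` of a permutation. What is left must avoid both patterns and, in addition,
every entry playing the `1` in a `213` or a `231` must lie below `v`. Hence the generating functions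
`avoiderSeries n μ`, which count the avoiders whose entries of this kind lie below `μ`, satisfy
`avoiderSeries (n + 1) μ = ∑_{v ≤ μ} x^v avoiderSeries n v + x^n avoiderSeries n μ`. The columns
`μ = 0` and `μ = 1` are explicit products, and for `n → ∞` column `μ` tends to
`∏_{i ≥ 1} (1 + x^i) / ∏_{i ≤ μ} (1 - x^i)`. The recursion preserves this limit with a first-order
correction, and for `2 ≤ v` the factor `x^v` improves an error `O(x^(2n))` to `O(x^(2n+2))`. In the
diagonal entry `avoiderSeries (n + 2) n`, which counts all avoiders, the correction and the factors
`1 - x^i` with `i > n` combine to `1 - x^(n+1) (2 + 2x) / (1 - x)`.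
-/

section Patterns

theorem containsPattern_iff_exists_strictMono {m n : ℕ} (p : Equiv.Perm (Fin m))
    (π : Equiv.Perm (Fin n)) :
    ContainsPattern p π ↔ ∃ a : Fin m → Fin n, StrictMono a ∧ StrictMono (π ∘ a ∘ p.symm) := by
  constructor
  · rintro ⟨f, hf⟩
    exact ⟨f, f.strictMono, fun s t hst ↦ (hf _ _).1 (by simpa using hst)⟩
  · rintro ⟨a, ha, hπ⟩
    exact ⟨OrderEmbedding.ofStrictMono a ha, fun i j ↦
      by simpa using (hπ.lt_iff_lt (a := p i) (b := p j)).symm⟩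

variable {n : ℕ} (π : Equiv.Perm (Fin n))

theorem containsPattern_perm1324_iff :
    ContainsPattern perm1324 π ↔
      ∃ i j k l, (i < j ∧ j < k ∧ k < l) ∧ π i < π k ∧ π k < π j ∧ π j < π l := by
  rw [containsPattern_iff_exists_strictMono, ← FinVec.exists_iff]
  simp [FinVec.Exists, Fin.strictMono_iff_lt_succ, Fin.forall_fin_succ, perm1324]

theorem containsPattern_perm1342_iff :
    ContainsPattern perm1342 π ↔
      ∃ i j k l, (i < j ∧ j < k ∧ k < l) ∧ π i < π l ∧ π l < π j ∧ π j < π k := by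
  rw [containsPattern_iff_exists_strictMono, ← FinVec.exists_iff]
  simp [FinVec.Exists, Fin.strictMono_iff_lt_succ, Fin.forall_fin_succ, perm1342]

/-- The entries of `π` at positions `j` and `k` are the `2` and the `1` in an occurrence of
`213` or `231`. -/
def Has213Or231At {n : ℕ} (π : Equiv.Perm (Fin n)) (j k : Fin n) : Prop :=
  j < k ∧ π k < π j ∧ ∃ l, j < l ∧ π j < π l

theorem avoidsAll_basis1324And1342_iff :
    AvoidsAll basis1324And1342 π ↔ ∀ i j k, i < j → Has213Or231At π j k → π k < π i := by
  have avoids_iff : AvoidsAll basis1324And1342 π ↔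
      ¬ ContainsPattern perm1324 π ∧ ¬ ContainsPattern perm1342 π := by
    simp [AvoidsAll, basis1324And1342]
  rw [avoids_iff, containsPattern_perm1324_iff, containsPattern_perm1342_iff]
  constructor
  · rintro ⟨h1324, h1342⟩ i j k hij ⟨hjk, hkj, l, hjl, hjl'⟩
    by_contra! hik
    have hik' : π i < π k := hik.lt_of_ne (π.injective.ne (hij.trans hjk).ne)
    rcases lt_trichotomy k l with hkl | rfl | hlk
    · exact h1324 ⟨i, j, k, l, ⟨hij, hjk, hkl⟩, hik', hkj, hjl'⟩
    · exact lt_asymm hkj hjl'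
    · exact h1342 ⟨i, j, l, k, ⟨hij, hjl, hlk⟩, hik', hkj, hjl'⟩
  · refine fun h ↦ ⟨?_, ?_⟩
    · rintro ⟨i, j, k, l, ⟨hij, hjk, hkl⟩, hik, hkj, hjl⟩
      exact lt_asymm hik (h i j k hij ⟨hjk, hkj, l, hjk.trans hkl, hjl⟩)
    · rintro ⟨i, j, l, k, ⟨hij, hjl, hlk⟩, hik, hkj, hjl'⟩
      exact lt_asymm hik (h i j k hij ⟨hjl.trans hlk, hkj, l, hjl, hjl'⟩)

/-- The permutation `π` avoids `1324` and `1342`, and does so even after an entry exceeding exactly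
the entries `0, …, μ - 1` of `π` has been put in front of it. -/
def AvoidsAfter (μ : ℕ) : Prop :=
  AvoidsAll basis1324And1342 π ∧ ∀ j k, Has213Or231At π j k → (π k : ℕ) < μ

theorem avoidsAfter_of_le {μ : ℕ} (h : n ≤ μ + 2) :
    AvoidsAfter π μ ↔ AvoidsAll basis1324And1342 π := by
  refine and_iff_left ?_
  rintro j k ⟨-, hkj, l, -, hjl⟩
  have := (π l).isLt
  rw [Fin.lt_def] at hkj hjl
  omega

end Patterns

/-- The permutation whose first entry is `v` and whose remaining entries are order-isomorphic
to `σ`. -/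
def prependPerm {n : ℕ} (v : Fin (n + 1)) (σ : Equiv.Perm (Fin n)) : Equiv.Perm (Fin (n + 1)) :=
  (finSuccEquiv' 0).trans ((Equiv.optionCongr σ).trans (finSuccEquiv' v).symm)

section Prepend

variable {n : ℕ} (v : Fin (n + 1)) (σ : Equiv.Perm (Fin n))

@[simp]
theorem prependPerm_zero : prependPerm v σ 0 = v := by
  simp [prependPerm]

@[simp]
theorem prependPerm_succ (i : Fin n) : prependPerm v σ i.succ = v.succAbove (σ i) := by
  have h : finSuccEquiv' (0 : Fin (n + 1)) i.succ = some i := by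
    rw [← Fin.succAbove_zero, finSuccEquiv'_succAbove]
  simp [prependPerm, h]

theorem prependPerm_bijective (n : ℕ) :
    Function.Bijective fun q : Fin (n + 1) × Equiv.Perm (Fin n) ↦ prependPerm q.1 q.2 := by
  rw [Fintype.bijective_iff_injective_and_card]
  refine ⟨?_, by simp [Fintype.card_perm, Nat.factorial_succ]⟩
  rintro ⟨v, σ⟩ ⟨w, τ⟩ h
  obtain rfl : v = w := by simpa using DFunLike.congr_fun h 0
  exact Prod.ext rfl (Equiv.ext fun i ↦ by simpa using DFunLike.congr_fun h i.succ)

theorem inversionCount_prependPerm :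
    inversionCount (prependPerm v σ) = v + inversionCount σ := by
  have smaller : (Finset.univ.filter fun i ↦ (σ i).castSucc < v).card = v := by
    rw [← Fin.card_Iio v]
    refine Finset.card_nbij (fun i ↦ (σ i).castSucc) (fun _ ↦ by simp)
      ((Fin.castSucc_injective n).comp σ.injective).injOn fun w hw ↦ ?_
    have hwv : w < v := by simpa using hw
    exact ⟨σ.symm (w.castPred (Fin.ne_last_of_lt hwv)), by simpa using hwv, by simp⟩
  simp only [inversionCount, Finset.card_filter, Fintype.sum_prod_type, Fin.sum_univ_succ,
    prependPerm_zero, prependPerm_succ, false_and, Fin.succ_pos, true_and,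
    Fin.not_lt_zero, if_false, zero_add, Fin.succ_lt_succ_iff, Fin.succAbove_lt_succAbove_iff,
    Fin.succAbove_lt_iff_castSucc_lt]
  rw [← Finset.card_filter, smaller]

theorem has213Or231At_prependPerm_succ (j k : Fin n) :
    Has213Or231At (prependPerm v σ) j.succ k.succ ↔ Has213Or231At σ j k := by
  simp [Has213Or231At, Fin.exists_fin_succ]

theorem has213Or231At_prependPerm_zero (k : Fin n) :
    Has213Or231At (prependPerm v σ) 0 k.succ ↔ (σ k).castSucc < v ∧ (v : ℕ) < n := by
  have larger : (∃ l, v ≤ (σ l).castSucc) ↔ (v : ℕ) < n :=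
    ⟨fun ⟨l, hl⟩ ↦ (Fin.le_def.1 hl).trans_lt (σ l).isLt,
      fun hv ↦ ⟨σ.symm ⟨v, hv⟩, by simp⟩⟩
  simp [Has213Or231At, Fin.exists_fin_succ, Fin.succAbove_lt_iff_castSucc_lt,
    Fin.lt_succAbove_iff_le_castSucc, larger]

theorem not_has213Or231At_zero_right (π : Equiv.Perm (Fin (n + 1))) (j : Fin (n + 1)) :
    ¬ Has213Or231At π j 0 :=
  fun h ↦ Fin.not_lt_zero _ h.1

theorem avoidsAll_prependPerm :
    AvoidsAll basis1324And1342 (prependPerm v σ) ↔ AvoidsAfter σ v := by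
  simp only [AvoidsAfter, avoidsAll_basis1324And1342_iff, Fin.forall_fin_succ (n := n),
    not_has213Or231At_zero_right, has213Or231At_prependPerm_succ, prependPerm_zero,
    prependPerm_succ, Fin.succ_lt_succ_iff, Fin.succAbove_lt_succAbove_iff, Fin.not_lt_zero,
    Fin.succAbove_lt_iff_castSucc_lt, Fin.succ_pos, forall_const, false_imp_iff, imp_true_iff,
    true_and]
  exact and_comm

theorem forall_castSucc_lt_imp_succAbove_lt_iff (μ : ℕ) :
    (∀ k, (σ k).castSucc < v ∧ (v : ℕ) < n → (v.succAbove (σ k) : ℕ) < μ) ↔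
      (v : ℕ) ≤ μ ∨ (v : ℕ) = n := by
  constructor
  · intro h
    by_contra! hv
    have hμ : (⟨μ, by omega⟩ : Fin n).castSucc < v := hv.1
    have := h (σ.symm ⟨μ, by omega⟩) (by simpa using ⟨hμ, by omega⟩)
    simp [Fin.succAbove_of_castSucc_lt _ _ hμ] at this
  · rintro hv k ⟨hk, hvn⟩
    rw [Fin.succAbove_of_castSucc_lt _ _ hk]
    exact (Fin.lt_def.1 hk).trans_le (hv.resolve_right hvn.ne)

theorem avoidsAfter_prependPerm (μ : ℕ) :
    AvoidsAfter (prependPerm v σ) μ ↔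
      ((v : ℕ) ≤ μ ∨ (v : ℕ) = n) ∧ AvoidsAfter σ (min v μ) := by
  have split_min : AvoidsAfter σ (min v μ) ↔
      AvoidsAfter σ v ∧ ∀ j k, Has213Or231At σ j k → (σ k : ℕ) < μ := by
    simp only [AvoidsAfter, lt_min_iff, imp_and, forall_and, and_assoc]
  rw [AvoidsAfter, avoidsAll_prependPerm, split_min, and_left_comm, and_congr_right_iff]
  intro h
  have unshifted {j k : Fin n} (hjk : Has213Or231At σ j k) : (v.succAbove (σ k) : ℕ) = σ k := by
    rw [Fin.succAbove_of_castSucc_lt _ _ (h.2 j k hjk), Fin.val_castSucc]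
  simp only [Fin.forall_fin_succ (n := n), not_has213Or231At_zero_right,
    has213Or231At_prependPerm_succ, has213Or231At_prependPerm_zero, prependPerm_succ,
    forall_castSucc_lt_imp_succAbove_lt_iff, false_imp_iff, true_and]
  exact and_congr_right fun _ ↦ forall₃_congr fun j k hjk ↦ by rw [unshifted hjk]

end Prepend

open Classical in
/-- The inversion generating function of the permutations of length `n` that satisfy
`AvoidsAfter · μ`. -/
noncomputable def avoiderSeries (n μ : ℕ) : ℚ⟦X⟧ :=
  ∑ σ : Equiv.Perm (Fin n) with AvoidsAfter σ μ, X ^ inversionCount σ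

theorem coeff_avoiderSeries {n μ : ℕ} (h : n ≤ μ + 2) (k : ℕ) :
    coeff k (avoiderSeries n μ) = av n k basis1324And1342 := by
  classical
  have avSet_eq : AvSet n k basis1324And1342 =
      ({σ | AvoidsAfter σ μ ∧ k = inversionCount σ} : Finset (Equiv.Perm (Fin n))) := by
    ext σ
    simp [AvSet, avoidsAfter_of_le σ h, eq_comm]
  rw [av, avSet_eq, Set.ncard_coe_finset]
  simp [avoiderSeries, coeff_X_pow, Finset.filter_filter]

theorem avoiderSeries_eq_of_le {n μ ν : ℕ} (hμ : n ≤ μ + 2) (hν : n ≤ ν + 2) :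
    avoiderSeries n μ = avoiderSeries n ν := by
  ext k
  rw [coeff_avoiderSeries hμ, coeff_avoiderSeries hν]

theorem avoiderSeries_succ {n μ : ℕ} (h : μ < n) :
    avoiderSeries (n + 1) μ =
      ∑ v ∈ Finset.range (μ + 1), X ^ v * avoiderSeries n v + X ^ n * avoiderSeries n μ := by
  classical
  have first_entry : avoiderSeries (n + 1) μ = ∑ v ∈ Finset.range (n + 1),
      if v ≤ μ ∨ v = n then X ^ v * avoiderSeries n (min v μ) else 0 := by
    simp only [avoiderSeries, Finset.sum_filter, ← (prependPerm_bijective n).sum_comp,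
      Fintype.sum_prod_type, Finset.sum_range, avoidsAfter_prependPerm, inversionCount_prependPerm,
      pow_add, Finset.mul_sum, mul_ite, mul_zero, ite_and, Finset.sum_ite_irrel,
      Finset.sum_const_zero]
  rw [first_entry, Finset.sum_range_succ, if_pos (.inr rfl), min_eq_right h.le, add_left_inj,
    ← Finset.sum_filter]
  have small_entries : {v ∈ Finset.range n | v ≤ μ ∨ v = n} = Finset.range (μ + 1) := by
    ext v
    simp only [Finset.mem_filter, Finset.mem_range]
    omega
  rw [small_entries]
  refine Finset.sum_congr rfl fun v hv ↦ ?_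
  rw [min_eq_left (Nat.lt_succ_iff.1 (Finset.mem_range.1 hv))]

theorem avoiderSeries_one (μ : ℕ) : avoiderSeries 1 μ = 1 := by
  have avoids (σ : Equiv.Perm (Fin 1)) : AvoidsAfter σ μ := by
    rw [avoidsAfter_of_le σ (by omega), avoidsAll_basis1324And1342_iff]
    exact fun i j _ hij ↦ absurd hij (Subsingleton.elim i j).not_lt
  have no_inversions : inversionCount (1 : Equiv.Perm (Fin 1)) = 0 := by decide
  simp [avoiderSeries, avoids, Subsingleton.elim _ (1 : Equiv.Perm (Fin 1)), no_inversions]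

theorem avoiderSeries_zero_right (n : ℕ) :
    avoiderSeries (n + 1) 0 = ∏ i ∈ Finset.range n, (1 + X ^ (i + 1)) := by
  induction n with
  | zero => simp [avoiderSeries_one]
  | succ n ih =>
    rw [avoiderSeries_succ (n := n + 1) (by omega), Finset.prod_range_succ, zero_add,
      Finset.sum_range_one, ih]
    ring

theorem one_sub_X_mul_avoiderSeries_one_right (n : ℕ) :
    (1 - X) * avoiderSeries (n + 2) 1 = (1 - X ^ (n + 2)) * avoiderSeries (n + 1) 0 := by
  induction n with
  | zero =>
    rw [avoiderSeries_eq_of_le (ν := 0) (by simp) (by simp), avoiderSeries_zero_right,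
      avoiderSeries_zero_right]
    simp only [Finset.prod_range_succ, Finset.prod_range_zero]
    ring
  | succ n ih =>
    have zero_right :
        avoiderSeries (n + 2) 0 = (1 + X ^ (n + 1)) * avoiderSeries (n + 1) 0 := by
      simp only [avoiderSeries_zero_right, Finset.prod_range_succ, mul_comm]
    rw [avoiderSeries_succ (n := n + 2) (by omega), Finset.sum_range_succ,
      Finset.sum_range_one]
    linear_combination (X + X ^ (n + 2)) * ih - X * (1 - X ^ (n + 2)) * zero_right

theorem sq_dvd_prod_one_add_sub {ι R : Type*} [CommRing R] {d : R} {f : ι → R}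
    (hf : ∀ i, d ∣ f i) (s : Finset ι) :
    d ^ 2 ∣ ∏ i ∈ s, (1 + f i) - (1 + ∑ i ∈ s, f i) := by
  classical
  induction s using Finset.induction_on with
  | empty => simp
  | insert i s hi ih =>
    rw [Finset.prod_insert hi, Finset.sum_insert hi]
    have cross : d ^ 2 ∣ f i * ∑ i ∈ s, f i :=
      sq d ▸ mul_dvd_mul (hf i) (Finset.dvd_sum fun j _ ↦ hf j)
    convert (ih.mul_left (1 + f i)).add cross using 1
    ring

theorem isClosed_setOf_X_pow_dvd {R : Type*} [Semiring R] [TopologicalSpace R] [T1Space R]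
    (n : ℕ) : IsClosed {f : R⟦X⟧ | X ^ n ∣ f} := by
  simp only [X_pow_dvd_iff, Set.ofPred_forall]
  exact isClosed_iInter fun m ↦ isClosed_iInter fun _ ↦
    isClosed_singleton.preimage (WithPiTopology.continuous_coeff R m)

section TailProduct

variable {K : Type*} [Field K] [TopologicalSpace K]

theorem multipliable_one_add_mul_X_pow (a : K⟦X⟧) (n : ℕ) :
    Multipliable fun i : ℕ ↦ 1 + a * X ^ (n + i) := by
  apply WithPiTopology.multipliable_one_add_of_tendsto_order_atTop_nhds_top
  refine ENat.tendsto_nhds_top_iff_natCast_lt.2 fun m ↦ ?_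
  filter_upwards [Filter.eventually_gt_atTop m] with i hi
  calc (m : ℕ∞) < (n + i : ℕ) := by exact_mod_cast Nat.lt_add_left n hi
    _ = order (X ^ (n + i) : K⟦X⟧) := (order_X_pow _).symm
    _ ≤ order a + order (X ^ (n + i) : K⟦X⟧) := le_add_self
    _ ≤ order (a * X ^ (n + i)) := le_order_mul ..

/-- The product `∏_{i ≥ n} (1 + a x^i)`. -/
noncomputable def tailProduct (a : K⟦X⟧) (n : ℕ) : K⟦X⟧ :=
  ∏' i : ℕ, (1 + a * X ^ (n + i))

variable [IsTopologicalRing K] [T2Space K]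

theorem tailProduct_eq_mul (a : K⟦X⟧) (n : ℕ) :
    tailProduct a n = (1 + a * X ^ n) * tailProduct a (n + 1) := by
  have shift : (fun i : ℕ ↦ 1 + a * X ^ (n + (i + 1))) = fun i ↦ 1 + a * X ^ (n + 1 + i) := by
    funext i
    rw [add_assoc n, add_comm 1 i]
  rw [tailProduct, tprod_eq_zero_mul' (shift ▸ multipliable_one_add_mul_X_pow a (n + 1)), shift,
    add_zero, tailProduct]

theorem hasSum_mul_X_pow (a : K⟦X⟧) (n : ℕ) :
    HasSum (fun i : ℕ ↦ a * X ^ (n + i)) (a * X ^ n * (1 - X)⁻¹) := by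
  have constantCoeff_X : constantCoeff (X : K⟦X⟧) = 0 := by simp
  have tsum_eq : ∑' i : ℕ, (X : K⟦X⟧) ^ i = (1 - X)⁻¹ :=
    (eq_inv_iff_mul_eq_one (by simp)).2
      (WithPiTopology.tsum_pow_mul_one_sub_of_constantCoeff_eq_zero constantCoeff_X)
  have geometric : HasSum (fun i : ℕ ↦ (X : K⟦X⟧) ^ i) (1 - X)⁻¹ :=
    tsum_eq ▸ (WithPiTopology.summable_pow_of_constantCoeff_eq_zero constantCoeff_X).hasSum
  simp only [pow_add, ← mul_assoc]
  exact geometric.mul_left (a * X ^ n)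

theorem X_pow_dvd_tailProduct_sub (a : K⟦X⟧) (n : ℕ) :
    X ^ (2 * n) ∣ tailProduct a n - (1 + a * X ^ n * (1 - X)⁻¹) := by
  refine (isClosed_setOf_X_pow_dvd (2 * n)).mem_of_tendsto
    ((multipliable_one_add_mul_X_pow a n).hasProd.sub ((hasSum_mul_X_pow a n).const_add 1))
    (.of_forall fun s ↦ ?_)
  rw [Set.mem_ofPred, mul_comm 2, pow_mul]
  exact sq_dvd_prod_one_add_sub (fun i ↦ ⟨a * X ^ i, by ring⟩) s

end TailProduct

theorem overpartitionSeries_mul_tailProduct_neg_one :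
    overpartitionSeries * tailProduct (-1) 1 = tailProduct 1 1 := by
  rw [overpartitionSeries, tailProduct,
    ← multipliable_overpartitionSeries.tprod_mul (multipliable_one_add_mul_X_pow _ _), tailProduct]
  refine tprod_congr fun i ↦ ?_
  have h : (1 - X ^ (i + 1) : ℚ⟦X⟧) * (1 - X ^ (i + 1))⁻¹ = 1 :=
    PowerSeries.mul_inv_cancel _ (by simp)
  linear_combination (1 + X ^ (i + 1)) * h

theorem avoiderSeries_zero_right_mul_tailProduct (n : ℕ) :
    avoiderSeries (n + 1) 0 * tailProduct 1 (n + 1) = tailProduct 1 1 := by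
  induction n with
  | zero => simp [avoiderSeries_one]
  | succ n ih =>
    rw [← ih, tailProduct_eq_mul 1 (n + 1), avoiderSeries_zero_right, avoiderSeries_zero_right,
      Finset.prod_range_succ]
    ring

theorem one_sub_X_mul_inv : (1 - X : ℚ⟦X⟧) * (1 - X)⁻¹ = 1 :=
  PowerSeries.mul_inv_cancel _ (by simp)

/-- The coefficientwise limit of `avoiderSeries n μ` as `n → ∞`, that is
`∏_{i ≥ 1} (1 + x^i) / ∏_{1 ≤ i ≤ μ} (1 - x^i)`. -/
noncomputable def limitSeries (μ : ℕ) : ℚ⟦X⟧ :=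
  overpartitionSeries * tailProduct (-1) (μ + 1)

theorem limitSeries_zero : limitSeries 0 = tailProduct 1 1 :=
  overpartitionSeries_mul_tailProduct_neg_one

theorem limitSeries_eq_mul (μ : ℕ) :
    limitSeries μ = (1 - X ^ (μ + 1)) * limitSeries (μ + 1) := by
  rw [limitSeries, limitSeries, tailProduct_eq_mul]
  ring

theorem X_pow_dvd_limitSeries_sub (μ : ℕ) :
    X ^ (2 * (μ + 1)) ∣
      limitSeries μ - overpartitionSeries * (1 - X ^ (μ + 1) * (1 - X)⁻¹) := by
  convert (X_pow_dvd_tailProduct_sub (-1) (μ + 1)).mul_left overpartitionSeries using 1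
  rw [limitSeries]
  ring

/-- `limitSeries μ` with its first-order correction in `n`; it approximates
`avoiderSeries (n + 2) μ` with error of order at least `2 * n`. -/
noncomputable def correctedLimitSeries (n μ : ℕ) : ℚ⟦X⟧ :=
  limitSeries μ * (1 - X ^ (n + 1) * (X + (1 + X) * (1 - X ^ μ)) * (1 - X)⁻¹)

theorem correctedLimitSeries_zero_right (n : ℕ) :
    correctedLimitSeries n 0 = limitSeries 0 * (1 - X ^ (n + 2) * (1 - X)⁻¹) := by
  rw [correctedLimitSeries]
  ring

theorem sum_X_pow_mul_correctedLimitSeries (n m : ℕ) :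
    ∑ v ∈ Finset.range (m + 1), X ^ v * correctedLimitSeries n v =
      limitSeries m * (1 - X ^ (n + 2) * (1 + (1 + X) * (1 - X ^ m)) * (1 - X)⁻¹) := by
  induction m with
  | zero =>
    rw [zero_add, Finset.sum_range_one, correctedLimitSeries_zero_right]
    ring
  | succ m ih =>
    rw [Finset.sum_range_succ, ih, correctedLimitSeries, limitSeries_eq_mul m]
    ring

theorem correctedLimitSeries_succ (n m : ℕ) :
    correctedLimitSeries (n + 1) m =
      ∑ v ∈ Finset.range (m + 1), X ^ v * correctedLimitSeries n v +
        X ^ (n + 2) * limitSeries m := by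
  rw [sum_X_pow_mul_correctedLimitSeries, correctedLimitSeries]
  linear_combination X ^ (n + 2) * limitSeries m * one_sub_X_mul_inv

theorem X_pow_dvd_avoiderSeries_zero_right_sub (n : ℕ) :
    X ^ (2 * (n + 1)) ∣
      avoiderSeries (n + 1) 0 - limitSeries 0 * (1 - X ^ (n + 1) * (1 - X)⁻¹) := by
  obtain ⟨w, hw⟩ := X_pow_dvd_tailProduct_sub (1 : ℚ⟦X⟧) (n + 1)
  refine ⟨avoiderSeries (n + 1) 0 *
    ((1 - X)⁻¹ ^ 2 - w * (1 - X ^ (n + 1) * (1 - X)⁻¹)), ?_⟩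
  rw [limitSeries_zero, ← avoiderSeries_zero_right_mul_tailProduct n]
  linear_combination -avoiderSeries (n + 1) 0 * (1 - X ^ (n + 1) * (1 - X)⁻¹) * hw

theorem X_pow_dvd_avoiderSeries_one_right_sub (n : ℕ) :
    X ^ (2 * (n + 1)) ∣ avoiderSeries (n + 2) 1 - correctedLimitSeries n 1 := by
  obtain ⟨w, hw⟩ := X_pow_dvd_avoiderSeries_zero_right_sub n
  refine ⟨(1 - X)⁻¹ * ((1 - X ^ (n + 2)) * w + X * (1 - X)⁻¹ * limitSeries 0), ?_⟩
  have key : (1 - X) * (avoiderSeries (n + 2) 1 - correctedLimitSeries n 1) =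
      X ^ (2 * (n + 1)) * ((1 - X ^ (n + 2)) * w + X * (1 - X)⁻¹ * limitSeries 0) := by
    rw [correctedLimitSeries]
    linear_combination one_sub_X_mul_avoiderSeries_one_right n + (1 - X ^ (n + 2)) * hw +
      (1 - X ^ (n + 1) * (1 + X - X ^ 2) * (1 - X)⁻¹) * limitSeries_eq_mul 0 +
      X ^ (n + 2) * limitSeries 0 * one_sub_X_mul_inv
  linear_combination (1 - X)⁻¹ * key -
    (avoiderSeries (n + 2) 1 - correctedLimitSeries n 1) * one_sub_X_mul_inv

section Induction

variable {n : ℕ} (hn : 1 ≤ n)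
  (ih : ∀ μ ≤ n, X ^ (2 * n) ∣ avoiderSeries (n + 2) μ - correctedLimitSeries n μ)
include hn ih

theorem X_pow_dvd_avoiderSeries_sub_limitSeries {μ : ℕ} (hμ : μ ≤ n + 1) :
    X ^ (n + 1) ∣ avoiderSeries (n + 2) μ - limitSeries μ := by
  have of_le {ν : ℕ} (hν : ν ≤ n) : X ^ (n + 1) ∣ avoiderSeries (n + 2) ν - limitSeries ν := by
    have correction : X ^ (n + 1) ∣ correctedLimitSeries n ν - limitSeries ν :=
      ⟨-limitSeries ν * (X + (1 + X) * (1 - X ^ ν)) * (1 - X)⁻¹, by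
        rw [correctedLimitSeries]; ring⟩
    simpa only [sub_add_sub_cancel] using
      ((pow_dvd_pow X (by omega)).trans (ih ν hν)).add correction
  obtain rfl | hμ : μ = n + 1 ∨ μ ≤ n := by omega
  · rw [avoiderSeries_eq_of_le (ν := n) (by omega) le_rfl]
    convert (of_le le_rfl).sub (dvd_mul_right _ (limitSeries (n + 1))) using 1
    rw [limitSeries_eq_mul n]
    ring
  · exact of_le hμ

theorem X_pow_dvd_X_pow_mul_avoiderSeries_sub {v : ℕ} (hv : v ≤ n + 1) :
    X ^ (2 * (n + 1)) ∣ X ^ v * (avoiderSeries (n + 2) v - correctedLimitSeries n v) := by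
  obtain rfl | rfl | rfl | hv : v = 0 ∨ v = 1 ∨ v = n + 1 ∨ 2 ≤ v ∧ v ≤ n := by omega
  · rw [pow_zero, one_mul, correctedLimitSeries_zero_right]
    exact (pow_dvd_pow X (by omega)).trans (X_pow_dvd_avoiderSeries_zero_right_sub (n + 1))
  · exact (X_pow_dvd_avoiderSeries_one_right_sub n).mul_left _
  · rw [two_mul, pow_add]
    refine mul_dvd_mul_left _ ?_
    convert (X_pow_dvd_avoiderSeries_sub_limitSeries hn ih le_rfl).add (dvd_mul_right (X ^ (n + 1))
      (limitSeries (n + 1) * (X + (1 + X) * (1 - X ^ (n + 1))) * (1 - X)⁻¹)) using 1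
    rw [correctedLimitSeries]
    ring
  · have := mul_dvd_mul (pow_dvd_pow (X : ℚ⟦X⟧) hv.1) (ih v hv.2)
    rwa [← pow_add, add_comm, ← Nat.mul_succ] at this

theorem X_pow_dvd_avoiderSeries_succ_sub {μ : ℕ} (hμ : μ ≤ n + 1) :
    X ^ (2 * (n + 1)) ∣ avoiderSeries (n + 3) μ - correctedLimitSeries (n + 1) μ := by
  have small_entries : X ^ (2 * (n + 1)) ∣ ∑ v ∈ Finset.range (μ + 1),
      X ^ v * (avoiderSeries (n + 2) v - correctedLimitSeries n v) :=
    Finset.dvd_sum fun v hv ↦ X_pow_dvd_X_pow_mul_avoiderSeries_sub hn ih <| by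
      rw [Finset.mem_range] at hv; omega
  have maximal_entry : X ^ (2 * (n + 1)) ∣
      X ^ (n + 2) * (avoiderSeries (n + 2) μ - limitSeries μ) := by
    have := mul_dvd_mul (pow_dvd_pow (X : ℚ⟦X⟧) (n + 1).le_succ)
      (X_pow_dvd_avoiderSeries_sub_limitSeries hn ih hμ)
    rwa [← pow_add, ← two_mul] at this
  convert small_entries.add maximal_entry using 1
  rw [avoiderSeries_succ (n := n + 2) (by omega), correctedLimitSeries_succ]
  simp only [mul_sub, Finset.sum_sub_distrib]
  ring

end Induction

theorem X_pow_dvd_avoiderSeries_sub {n : ℕ} (hn : 1 ≤ n) :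
    ∀ μ ≤ n, X ^ (2 * n) ∣ avoiderSeries (n + 2) μ - correctedLimitSeries n μ := by
  induction n, hn using Nat.le_induction with
  | base =>
    intro μ hμ
    obtain rfl | rfl : μ = 0 ∨ μ = 1 := by omega
    · rw [correctedLimitSeries_zero_right]
      exact (pow_dvd_pow X (by omega)).trans (X_pow_dvd_avoiderSeries_zero_right_sub 2)
    · exact (pow_dvd_pow X (by omega)).trans (X_pow_dvd_avoiderSeries_one_right_sub 1)
  | succ n hn ih => exact fun μ hμ ↦ X_pow_dvd_avoiderSeries_succ_sub hn ih hμ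

theorem X_pow_dvd_correctedLimitSeries_self_sub (n : ℕ) :
    X ^ (2 * n) ∣ correctedLimitSeries n n -
      overpartitionSeries * (1 - X ^ (n + 1) * (2 + 2 * X) * (1 - X)⁻¹) := by
  obtain ⟨w, hw⟩ := X_pow_dvd_limitSeries_sub n
  -- The terms linear in `X ^ (n + 1) * (1 - X)⁻¹` cancel, up to one with a further `X ^ n`.
  refine ⟨X ^ 2 * w * (1 - X ^ (n + 1) * (X + (1 + X) * (1 - X ^ n)) * (1 - X)⁻¹) +
    overpartitionSeries * (X * (1 + X) * (1 - X)⁻¹ +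
      X ^ 2 * (1 + 2 * X - X ^ n * (1 + X)) * (1 - X)⁻¹ ^ 2), ?_⟩
  rw [correctedLimitSeries]
  linear_combination (1 - X ^ (n + 1) * (X + (1 + X) * (1 - X ^ n)) * (1 - X)⁻¹) * hw

theorem av_eq_coeff {n k : ℕ} (h : k + 5 ≤ 2 * n) :
    (av n k basis1324And1342 : ℚ) =
      coeff k ((1 - X - X ^ (n - 1) * (2 + 2 * X)) * (1 - X)⁻¹ * overpartitionSeries) := by
  obtain ⟨m, rfl⟩ := Nat.exists_eq_add_of_le' (show 2 ≤ n by omega)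
  rw [← coeff_avoiderSeries (μ := m) le_rfl, ← sub_eq_zero, ← map_sub]
  refine X_pow_dvd_iff.1 ?_ k (show k < 2 * m by omega)
  convert (X_pow_dvd_avoiderSeries_sub (show 1 ≤ m by omega) m le_rfl).add
    (X_pow_dvd_correctedLimitSeries_self_sub m) using 1
  rw [show m + 2 - 1 = m + 1 by omega]
  linear_combination -overpartitionSeries * one_sub_X_mul_inv

theorem av_succ_sub_av_eq_coeff {n k : ℕ} (h : k + 5 ≤ 2 * n) :
    (av (n + 1) k basis1324And1342 : ℚ) - (av n k basis1324And1342 : ℚ) =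
      coeff k (X ^ (n - 1) * (2 + 2 * X) * overpartitionSeries) := by
  rw [av_eq_coeff (by omega), av_eq_coeff h, ← map_sub]
  congr 1
  obtain ⟨m, rfl⟩ := Nat.exists_eq_add_of_le' (show 1 ≤ n by omega)
  simp only [Nat.add_sub_cancel]
  linear_combination (X ^ m * (2 + 2 * X) * overpartitionSeries) * one_sub_X_mul_inv

theorem isLimitGenFun_overpartitionSeries :
    IsLimitGenFun basis1324And1342 overpartitionSeries := by
  refine fun k ↦ ⟨k + 5, fun n hn ↦ ?_⟩
  rw [av_eq_coeff (by omega), ← sub_eq_zero, ← map_sub]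
  refine X_pow_dvd_iff.1 ?_ k (show k < n - 1 by omega)
  refine ⟨-(2 + 2 * X) * (1 - X)⁻¹ * overpartitionSeries, ?_⟩
  linear_combination overpartitionSeries * one_sub_X_mul_inv

theorem coeff_overpartitionSeries_nonneg (k : ℕ) : 0 ≤ coeff k overpartitionSeries := by
  obtain ⟨N, hN⟩ := isLimitGenFun_overpartitionSeries k
  rw [← hN N le_rfl]
  exact Nat.cast_nonneg _

theorem coeff_X_pow_mul_overpartitionSeries_nonneg (k m : ℕ) :
    0 ≤ coeff k (X ^ m * (2 + 2 * X) * overpartitionSeries) := by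
  have nonneg (m : ℕ) : 0 ≤ coeff k (X ^ m * overpartitionSeries) := by
    rw [coeff_X_pow_mul']
    split_ifs
    exacts [coeff_overpartitionSeries_nonneg _, le_rfl]
  have expand : X ^ m * (2 + 2 * X) * overpartitionSeries =
      2 • (X ^ m * overpartitionSeries) + 2 • (X ^ (m + 1) * overpartitionSeries) := by
    simp only [nsmul_eq_mul, Nat.cast_ofNat]
    ring
  rw [expand, map_add, map_nsmul, map_nsmul]
  exact add_nonneg (nsmul_nonneg (nonneg _) _) (nsmul_nonneg (nonneg _) _)

theorem theorem6p12_general :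
    IsLimitGenFun basis1324And1342 overpartitionSeries ∧
    ∀ k n : ℕ, k + 5 ≤ 2 * n →
      0 ≤ (av (n + 1) k basis1324And1342 : ℚ) - (av n k basis1324And1342 : ℚ) ∧
      (av (n + 1) k basis1324And1342 : ℚ) - (av n k basis1324And1342 : ℚ)
        = coeff k (X ^ (n - 1) * (2 + 2 * X) * overpartitionSeries) ∧
      (av n k basis1324And1342 : ℚ)
        = coeff k ((1 - X - X ^ (n - 1) * (2 + 2 * X)) * (1 - X)⁻¹ * overpartitionSeries) := by
  refine ⟨isLimitGenFun_overpartitionSeries, fun k n h ↦ ?_⟩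
  have difference := av_succ_sub_av_eq_coeff h
  exact ⟨difference ▸ coeff_X_pow_mul_overpartitionSeries_nonneg k (n - 1), difference,
    av_eq_coeff h⟩

theorem theorem6p12 :
    IsLimitGenFun basis1324And1342 overpartitionSeries ∧
    ∀ k n : ℕ, ((k : ℚ) + 7) / 2 ≤ (n : ℚ) →
      0 ≤ (av (n + 1) k basis1324And1342 : ℚ) - (av n k basis1324And1342 : ℚ) ∧
      (av (n + 1) k basis1324And1342 : ℚ) - (av n k basis1324And1342 : ℚ)
        = coeff k (X ^ (n - 1) * (2 + 2 * X) * overpartitionSeries) ∧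
      (av n k basis1324And1342 : ℚ)
        = coeff k ((1 - X - X ^ (n - 1) * (2 + 2 * X)) * (1 - X)⁻¹ * overpartitionSeries) := by
  refine theorem6p12_general.imp_right fun h k n hn ↦ h k n ?_
  exact_mod_cast (by linarith : (k : ℚ) + 5 ≤ 2 * n)
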